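/- Let $R$ be a prime ring, that is, a nonzero associative ring, not necessarily with unity, such that for $a,b\in R$, $aRb=0$ implies $a=0$ or $b=0$. Let $Z(R)$ be its center, let $Q_s(R)$ be its Martindale symmetric ring of quotients, and let $C$ be the extended centroid of $R$, i.e. the center of $Q_s(R)$ (a field). Write $[a,b]=ab-ba$; for subsets $A,B$ let $[A,B]$ (resp. $AB$) be the additive subgroup generated by all $[a,b]$ (resp. $ab$) with $a\in A$, $b\in B$, and let $A^m$ be the corresponding $m$-fold product, for $m\ge 1$. For $A\subseteq R$, $AC$ is thus the $C$-linear span of $A$ in $Q_s(R)$. A Lie ideal of $R$ is an additive subgroup $L$ with $[L,R]\subseteq L$; it is noncentral if $L\not\subseteq Z(R)$. The ring $R$ is called exceptional if $\operatorname{char}R=2$ and $\dim_C RC=4$. Let $K$ and $L$ be noncentral Lie ideals of $R$ and let $m,n$ be positive integers. Then the following are equivalent: (i) $[K^m,L^n]=0$; (ii) $[K,L]=0$; (iii) $R$ is exceptional, and $KC=LC=Ca+C$ for every $a\in L\setminus Z(R)$. -/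

import Mathlib

namespace PrimeLie

universe u

section Additive

variable {R : Type u} [NonUnitalRing R]

/-- `[A, B]`: the additive subgroup generated by all `ab - ba` with `a ∈ A`, `b ∈ B`. -/
def commutator (A B : Set R) : AddSubgroup R :=
  AddSubgroup.closure {x | ∃ a ∈ A, ∃ b ∈ B, x = a * b - b * a}

/-- `AB`: the additive subgroup generated by all `ab` with `a ∈ A`, `b ∈ B`. -/
def product (A B : Set R) : AddSubgroup R :=
  AddSubgroup.closure {x | ∃ a ∈ A, ∃ b ∈ B, x = a * b}

/-- `A ^ m` for `m ≥ 1`: `A ^ 1` is the additive subgroup generated by `A`, and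
`A ^ (m + 1) = A ^ m A`. The ring need not have a unit, so exponent `0` has no meaning; the value
there is arbitrary. -/
def power (A : Set R) : ℕ → AddSubgroup R
  | 0 => ⊥
  | 1 => AddSubgroup.closure A
  | (m + 2) => product (power A (m + 1) : Set R) A

/-- An additive subgroup `L` is a Lie ideal if `[L, R] ⊆ L`. -/
def IsLieIdeal (L : AddSubgroup R) : Prop :=
  commutator (L : Set R) Set.univ ≤ L

/-- An additive subgroup is central if it is contained in the center `Z(R)`. -/
def IsCentral (L : AddSubgroup R) : Prop :=
  ∀ a ∈ L, a ∈ NonUnitalSubring.center R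

end Additive

/-- A (not necessarily unital) nonzero ring is prime if `aRb = 0` implies `a = 0` or `b = 0`. -/
class IsPrimeRing (R : Type u) [NonUnitalRing R] : Prop extends Nontrivial R where
  eq_zero_or_eq_zero : ∀ a b : R, (∀ r : R, a * r * b = 0) → a = 0 ∨ b = 0

section Ideals

variable {R : Type u} [NonUnitalRing R]

/-- The product of two two-sided ideals. -/
def idealMul (I J : TwoSidedIdeal R) : TwoSidedIdeal R :=
  TwoSidedIdeal.mk' (product (I : Set R) (J : Set R) : Set R)
    (zero_mem _) (fun hx hy => add_mem hx hy) (fun hx => neg_mem hx)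
    (by
      intro x y hy
      refine AddSubgroup.closure_induction (p := fun y _ => x * y ∈ product (I : Set R) (J : Set R))
        ?_ ?_ ?_ ?_ hy
      · rintro _ ⟨a, ha, b, hb, rfl⟩
        exact AddSubgroup.subset_closure
          ⟨x * a, I.mul_mem_left x a ha, b, hb, (mul_assoc x a b).symm⟩
      · simp
      · intro y z _ _ h1 h2
        rw [mul_add]
        exact add_mem h1 h2
      · intro y _ h
        rw [mul_neg]
        exact neg_mem h)
    (by
      intro y x hy
      refine AddSubgroup.closure_induction (p := fun y _ => y * x ∈ product (I : Set R) (J : Set R))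
        ?_ ?_ ?_ ?_ hy
      · rintro _ ⟨a, ha, b, hb, rfl⟩
        exact AddSubgroup.subset_closure
          ⟨a, ha, b * x, J.mul_mem_right b x hb, mul_assoc a b x⟩
      · simp
      · intro y z _ _ h1 h2
        rw [add_mul]
        exact add_mem h1 h2
      · intro y _ h
        rw [neg_mul]
        exact neg_mem h)

theorem mem_idealMul {I J : TwoSidedIdeal R} {x : R} :
    x ∈ idealMul I J ↔ x ∈ product (I : Set R) (J : Set R) := by
  simp [idealMul]

theorem mul_mem_idealMul {I J : TwoSidedIdeal R} {a b : R} (ha : a ∈ I) (hb : b ∈ J) :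
    a * b ∈ idealMul I J :=
  mem_idealMul.2 (AddSubgroup.subset_closure ⟨a, ha, b, hb, rfl⟩)

theorem idealMul_induction {I J : TwoSidedIdeal R} {p : R → Prop}
    (hmul : ∀ a ∈ I, ∀ b ∈ J, p (a * b)) (h0 : p 0)
    (hadd : ∀ x ∈ idealMul I J, ∀ y ∈ idealMul I J, p x → p y → p (x + y))
    (hneg : ∀ x ∈ idealMul I J, p x → p (-x)) {x : R} (hx : x ∈ idealMul I J) : p x := by
  refine AddSubgroup.closure_induction (p := fun x _ => p x) ?_ h0 ?_ ?_ (mem_idealMul.1 hx)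
  · rintro _ ⟨a, ha, b, hb, rfl⟩
    exact hmul a ha b hb
  · intro x y hx hy
    exact hadd x (mem_idealMul.2 hx) y (mem_idealMul.2 hy)
  · intro x hx
    exact hneg x (mem_idealMul.2 hx)

theorem idealMul_le_left {I J : TwoSidedIdeal R} : idealMul I J ≤ I := by
  intro x hx
  exact idealMul_induction (fun a ha b _ => I.mul_mem_right a b ha) I.zero_mem
    (fun _ _ _ _ h1 h2 => I.add_mem h1 h2) (fun _ _ h => I.neg_mem h) hx

theorem idealMul_le_right {I J : TwoSidedIdeal R} : idealMul I J ≤ J := by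
  intro x hx
  exact idealMul_induction (fun a _ b hb => J.mul_mem_left a b hb) J.zero_mem
    (fun _ _ _ _ h1 h2 => J.add_mem h1 h2) (fun _ _ h => J.neg_mem h) hx

theorem idealMul_mono {I I' J J' : TwoSidedIdeal R} (h : I ≤ I') (k : J ≤ J') :
    idealMul I J ≤ idealMul I' J' := by
  intro x hx
  exact idealMul_induction (fun a ha b hb => mul_mem_idealMul (h ha) (k hb)) (zero_mem _)
    (fun _ _ _ _ h1 h2 => add_mem h1 h2) (fun _ _ h => neg_mem h) hx

theorem exists_mem_ne_zero {I : TwoSidedIdeal R} (hI : I ≠ ⊥) : ∃ a ∈ I, a ≠ 0 := by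
  by_contra h
  push Not at h
  refine hI (le_antisymm (fun x hx => ?_) bot_le)
  rw [h x hx]
  exact zero_mem _

theorem ne_bot_of_mem {I : TwoSidedIdeal R} {a : R} (ha : a ∈ I) (h : a ≠ 0) : I ≠ ⊥ := by
  rintro rfl
  exact h (by simpa using ha)

variable [IsPrimeRing R]

theorem idealMul_ne_bot {I J : TwoSidedIdeal R} (hI : I ≠ ⊥) (hJ : J ≠ ⊥) : idealMul I J ≠ ⊥ := by
  obtain ⟨a, ha, ha0⟩ := exists_mem_ne_zero hI
  obtain ⟨b, hb, hb0⟩ := exists_mem_ne_zero hJ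
  have : ∃ r : R, a * r * b ≠ 0 := by
    by_contra h
    push Not at h
    exact (IsPrimeRing.eq_zero_or_eq_zero a b h).elim ha0 hb0
  obtain ⟨r, hr⟩ := this
  exact ne_bot_of_mem (mul_mem_idealMul (I.mul_mem_right a r ha) hb) hr

theorem inf_ne_bot {I J : TwoSidedIdeal R} (hI : I ≠ ⊥) (hJ : J ≠ ⊥) : I ⊓ J ≠ ⊥ := by
  intro h
  refine idealMul_ne_bot hI hJ (le_antisymm ?_ bot_le)
  rw [← h]
  exact le_inf idealMul_le_left idealMul_le_right

theorem top_ne_bot' : (⊤ : TwoSidedIdeal R) ≠ ⊥ := by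
  obtain ⟨a, ha⟩ := exists_ne (0 : R)
  exact ne_bot_of_mem (I := ⊤) (a := a) trivial ha

end Ideals

/-- A representative of an element `q` of the Martindale symmetric ring of quotients of `R`: a
nonzero two-sided ideal `dom`, a right `R`-module map `x ↦ q x` from `dom` to `R` and a left
`R`-module map `x ↦ x q` from `dom` to `R` with `(x q) y = x (q y)`. The two maps are
recorded as functions on `R`; only their restrictions to `dom` matter. -/
structure QuotientRep (R : Type u) [NonUnitalRing R] where
  dom : TwoSidedIdeal R
  dom_ne_bot : dom ≠ ⊥
  left : R → R
  right : R → R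
  left_add : ∀ x ∈ dom, ∀ y ∈ dom, left (x + y) = left x + left y
  left_mul : ∀ x ∈ dom, ∀ r : R, left (x * r) = left x * r
  right_add : ∀ x ∈ dom, ∀ y ∈ dom, right (x + y) = right x + right y
  right_mul : ∀ x ∈ dom, ∀ r : R, right (r * x) = r * right x
  compat : ∀ x ∈ dom, ∀ y ∈ dom, right x * y = x * left y

namespace QuotientRep

variable {R : Type u} [NonUnitalRing R]

theorem left_zero (p : QuotientRep R) : p.left 0 = 0 := by
  simpa using p.left_add 0 p.dom.zero_mem 0 p.dom.zero_mem

theorem right_zero (p : QuotientRep R) : p.right 0 = 0 := by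
  simpa using p.right_add 0 p.dom.zero_mem 0 p.dom.zero_mem

theorem left_neg (p : QuotientRep R) {x : R} (hx : x ∈ p.dom) : p.left (-x) = -p.left x := by
  have h := p.left_add (-x) (p.dom.neg_mem hx) x hx
  rw [neg_add_cancel, left_zero] at h
  exact eq_neg_of_add_eq_zero_left h.symm

theorem right_neg (p : QuotientRep R) {x : R} (hx : x ∈ p.dom) : p.right (-x) = -p.right x := by
  have h := p.right_add (-x) (p.dom.neg_mem hx) x hx
  rw [neg_add_cancel, right_zero] at h
  exact eq_neg_of_add_eq_zero_left h.symm

theorem left_mem (p : QuotientRep R) {I J : TwoSidedIdeal R} (hI : I ≤ p.dom) {x : R}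
    (hx : x ∈ idealMul I J) : p.left x ∈ J := by
  refine idealMul_induction (p := fun x => p.left x ∈ J) ?_ ?_ ?_ ?_ hx
  · intro a ha b hb
    rw [p.left_mul a (hI ha)]
    exact J.mul_mem_left _ _ hb
  · rw [p.left_zero]
    exact J.zero_mem
  · intro x hx y hy h1 h2
    rw [p.left_add x (hI (idealMul_le_left hx)) y (hI (idealMul_le_left hy))]
    exact J.add_mem h1 h2
  · intro x hx h
    rw [p.left_neg (hI (idealMul_le_left hx))]
    exact J.neg_mem h

theorem right_mem (p : QuotientRep R) {I J : TwoSidedIdeal R} (hJ : J ≤ p.dom) {x : R}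
    (hx : x ∈ idealMul I J) : p.right x ∈ I := by
  refine idealMul_induction (p := fun x => p.right x ∈ I) ?_ ?_ ?_ ?_ hx
  · intro a ha b hb
    rw [p.right_mul b (hJ hb)]
    exact I.mul_mem_right _ _ ha
  · rw [p.right_zero]
    exact I.zero_mem
  · intro x hx y hy h1 h2
    rw [p.right_add x (hJ (idealMul_le_right hx)) y (hJ (idealMul_le_right hy))]
    exact I.add_mem h1 h2
  · intro x hx h
    rw [p.right_neg (hJ (idealMul_le_right hx))]
    exact I.neg_mem h

variable [IsPrimeRing R]

/-- Two representatives are identified if they agree on some nonzero ideal contained in both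
domains. -/
instance setoid (R : Type u) [NonUnitalRing R] [IsPrimeRing R] : Setoid (QuotientRep R) where
  r p q := ∃ J : TwoSidedIdeal R, J ≠ ⊥ ∧ J ≤ p.dom ∧ J ≤ q.dom ∧
    ∀ x ∈ J, p.left x = q.left x ∧ p.right x = q.right x
  iseqv :=
    { refl := fun p => ⟨p.dom, p.dom_ne_bot, le_rfl, le_rfl, fun _ _ => ⟨rfl, rfl⟩⟩
      symm := fun ⟨J, h0, h1, h2, h⟩ =>
        ⟨J, h0, h2, h1, fun x hx => ⟨(h x hx).1.symm, (h x hx).2.symm⟩⟩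
      trans := fun ⟨J, h0, h1, _, h⟩ ⟨J', h0', _, h2', h'⟩ =>
        ⟨J ⊓ J', inf_ne_bot h0 h0', inf_le_left.trans h1, inf_le_right.trans h2', fun x hx =>
          have hJ : x ∈ J := (inf_le_left : J ⊓ J' ≤ J) hx
          have hJ' : x ∈ J' := (inf_le_right : J ⊓ J' ≤ J') hx
          ⟨(h x hJ).1.trans (h' x hJ').1, (h x hJ).2.trans (h' x hJ').2⟩⟩ }

theorem equiv_of_agree {p q : QuotientRep R}
    (h : ∀ x ∈ p.dom, x ∈ q.dom → p.left x = q.left x ∧ p.right x = q.right x) : p ≈ q :=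
  ⟨p.dom ⊓ q.dom, inf_ne_bot p.dom_ne_bot q.dom_ne_bot, inf_le_left, inf_le_right, fun x hx =>
    h x ((inf_le_left : p.dom ⊓ q.dom ≤ p.dom) hx) ((inf_le_right : p.dom ⊓ q.dom ≤ q.dom) hx)⟩

/-- Left and right multiplication by an element of `R`. -/
def ofElem (r : R) : QuotientRep R where
  dom := ⊤
  dom_ne_bot := top_ne_bot'
  left x := r * x
  right x := x * r
  left_add x _ y _ := mul_add r x y
  left_mul x _ s := (mul_assoc r x s).symm
  right_add x _ y _ := add_mul x y r
  right_mul x _ s := mul_assoc s x r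
  compat x _ y _ := mul_assoc x r y

/-- The identity on `R`. -/
def one (R : Type u) [NonUnitalRing R] [IsPrimeRing R] : QuotientRep R where
  dom := ⊤
  dom_ne_bot := top_ne_bot'
  left x := x
  right x := x
  left_add _ _ _ _ := rfl
  left_mul _ _ _ := rfl
  right_add _ _ _ _ := rfl
  right_mul _ _ _ := rfl
  compat _ _ _ _ := rfl

/-- The pointwise negative. -/
def neg (p : QuotientRep R) : QuotientRep R where
  dom := p.dom
  dom_ne_bot := p.dom_ne_bot
  left x := -p.left x
  right x := -p.right x
  left_add x hx y hy := by rw [p.left_add x hx y hy, neg_add]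
  left_mul x hx r := by rw [p.left_mul x hx r, neg_mul]
  right_add x hx y hy := by rw [p.right_add x hx y hy, neg_add]
  right_mul x hx r := by rw [p.right_mul x hx r, mul_neg]
  compat x hx y hy := by rw [neg_mul, mul_neg, p.compat x hx y hy]

/-- The pointwise sum, on the intersection of the domains. -/
def add (p q : QuotientRep R) : QuotientRep R where
  dom := p.dom ⊓ q.dom
  dom_ne_bot := inf_ne_bot p.dom_ne_bot q.dom_ne_bot
  left x := p.left x + q.left x
  right x := p.right x + q.right x
  left_add x hx y hy := by
    rw [p.left_add x (inf_le_left (a := p.dom) hx) y (inf_le_left (a := p.dom) hy),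
      q.left_add x (inf_le_right (a := p.dom) hx) y (inf_le_right (a := p.dom) hy)]
    abel
  left_mul x hx r := by
    rw [p.left_mul x (inf_le_left (a := p.dom) hx), q.left_mul x (inf_le_right (a := p.dom) hx),
      add_mul]
  right_add x hx y hy := by
    rw [p.right_add x (inf_le_left (a := p.dom) hx) y (inf_le_left (a := p.dom) hy),
      q.right_add x (inf_le_right (a := p.dom) hx) y (inf_le_right (a := p.dom) hy)]
    abel
  right_mul x hx r := by
    rw [p.right_mul x (inf_le_left (a := p.dom) hx), q.right_mul x (inf_le_right (a := p.dom) hx),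
      mul_add]
  compat x hx y hy := by
    rw [add_mul, mul_add, p.compat x (inf_le_left (a := p.dom) hx) y (inf_le_left (a := p.dom) hy),
      q.compat x (inf_le_right (a := p.dom) hx) y (inf_le_right (a := p.dom) hy)]

/-- The product `pq`: `x ↦ p (q x)` and `x ↦ (x p) q`, on the ideal `q.dom * p.dom`, which
`q.left` maps into `p.dom` and `p.right` maps into `q.dom`. -/
def mul (p q : QuotientRep R) : QuotientRep R where
  dom := idealMul q.dom p.dom
  dom_ne_bot := idealMul_ne_bot q.dom_ne_bot p.dom_ne_bot
  left x := p.left (q.left x)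
  right x := q.right (p.right x)
  left_add x hx y hy := by
    rw [q.left_add x (idealMul_le_left hx) y (idealMul_le_left hy),
      p.left_add _ (q.left_mem le_rfl hx) _ (q.left_mem le_rfl hy)]
  left_mul x hx r := by
    rw [q.left_mul x (idealMul_le_left hx), p.left_mul _ (q.left_mem le_rfl hx)]
  right_add x hx y hy := by
    rw [p.right_add x (idealMul_le_right hx) y (idealMul_le_right hy),
      q.right_add _ (p.right_mem le_rfl hx) _ (p.right_mem le_rfl hy)]
  right_mul x hx r := by
    rw [p.right_mul x (idealMul_le_right hx), q.right_mul _ (p.right_mem le_rfl hx)]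
  compat x hx y hy := by
    rw [q.compat _ (p.right_mem le_rfl hx) y (idealMul_le_left hy),
      p.compat x (idealMul_le_right hx) _ (q.left_mem le_rfl hy)]

theorem neg_congr {p p' : QuotientRep R} (h : p ≈ p') : neg p ≈ neg p' := by
  obtain ⟨J, h0, h1, h2, h⟩ := h
  exact ⟨J, h0, h1, h2, fun x hx => ⟨congrArg Neg.neg (h x hx).1, congrArg Neg.neg (h x hx).2⟩⟩

theorem add_congr {p p' q q' : QuotientRep R} (h : p ≈ p') (k : q ≈ q') :
    add p q ≈ add p' q' := by
  obtain ⟨J, h0, h1, h2, h⟩ := h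
  obtain ⟨K, k0, k1, k2, k⟩ := k
  refine ⟨J ⊓ K, inf_ne_bot h0 k0, inf_le_inf h1 k1, inf_le_inf h2 k2, fun x hx => ?_⟩
  have hJ : x ∈ J := (inf_le_left : J ⊓ K ≤ J) hx
  have hK : x ∈ K := (inf_le_right : J ⊓ K ≤ K) hx
  exact ⟨congrArg₂ (· + ·) (h x hJ).1 (k x hK).1, congrArg₂ (· + ·) (h x hJ).2 (k x hK).2⟩

theorem mul_congr {p p' q q' : QuotientRep R} (h : p ≈ p') (k : q ≈ q') :
    mul p q ≈ mul p' q' := by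
  obtain ⟨J, h0, h1, h2, h⟩ := h
  obtain ⟨K, k0, k1, k2, k⟩ := k
  refine ⟨idealMul K J, idealMul_ne_bot k0 h0, idealMul_mono k1 h1, idealMul_mono k2 h2,
    fun x hx => ⟨?_, ?_⟩⟩
  · change p.left (q.left x) = p'.left (q'.left x)
    rw [← (k x (idealMul_le_left hx)).1, (h _ (q.left_mem k1 hx)).1]
  · change q.right (p.right x) = q'.right (p'.right x)
    rw [← (h x (idealMul_le_right hx)).2, (k _ (p.right_mem h1 hx)).2]

end QuotientRep

/-- The Martindale symmetric ring of quotients `Q_s(R)` of a prime ring `R`. -/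
def SymmetricQuotient (R : Type u) [NonUnitalRing R] [IsPrimeRing R] : Type u :=
  Quotient (QuotientRep.setoid R)

namespace SymmetricQuotient

open QuotientRep

variable {R : Type u} [NonUnitalRing R] [IsPrimeRing R]

instance : Zero (SymmetricQuotient R) := ⟨Quotient.mk _ (ofElem 0)⟩
instance : One (SymmetricQuotient R) := ⟨Quotient.mk _ (one R)⟩
instance : Neg (SymmetricQuotient R) := ⟨Quotient.map neg fun _ _ h => neg_congr h⟩
instance : Add (SymmetricQuotient R) :=
  ⟨Quotient.map₂ add fun _ _ h _ _ k => add_congr h k⟩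
instance : Mul (SymmetricQuotient R) :=
  ⟨Quotient.map₂ mul fun _ _ h _ _ k => mul_congr h k⟩

instance : Ring (SymmetricQuotient R) where
  add_assoc := by
    rintro ⟨p⟩ ⟨q⟩ ⟨r⟩
    exact Quotient.sound (equiv_of_agree fun x _ _ => ⟨add_assoc _ _ _, add_assoc _ _ _⟩)
  zero_add := by
    rintro ⟨p⟩
    exact Quotient.sound (equiv_of_agree fun x _ _ => by simp [add, ofElem])
  add_zero := by
    rintro ⟨p⟩
    exact Quotient.sound (equiv_of_agree fun x _ _ => by simp [add, ofElem])
  add_comm := by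
    rintro ⟨p⟩ ⟨q⟩
    exact Quotient.sound (equiv_of_agree fun x _ _ => ⟨add_comm _ _, add_comm _ _⟩)
  neg_add_cancel := by
    rintro ⟨p⟩
    exact Quotient.sound (equiv_of_agree fun x _ _ => by simp [add, neg, ofElem])
  mul_assoc := by
    rintro ⟨p⟩ ⟨q⟩ ⟨r⟩
    exact Quotient.sound (equiv_of_agree fun x _ _ => ⟨rfl, rfl⟩)
  one_mul := by
    rintro ⟨p⟩
    exact Quotient.sound (equiv_of_agree fun x _ _ => ⟨rfl, rfl⟩)
  mul_one := by
    rintro ⟨p⟩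
    exact Quotient.sound (equiv_of_agree fun x _ _ => ⟨rfl, rfl⟩)
  zero_mul := by
    rintro ⟨p⟩
    exact Quotient.sound (equiv_of_agree fun x _ _ => by simp [mul, ofElem, right_zero])
  mul_zero := by
    rintro ⟨p⟩
    exact Quotient.sound (equiv_of_agree fun x _ _ => by simp [mul, ofElem, left_zero])
  left_distrib := by
    rintro ⟨p⟩ ⟨q⟩ ⟨r⟩
    refine Quotient.sound (equiv_of_agree fun x _ hx => ⟨?_, rfl⟩)
    have h1 : x ∈ idealMul q.dom p.dom := (inf_le_left : (mul p q).dom ⊓ (mul p r).dom ≤ _) hx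
    have h2 : x ∈ idealMul r.dom p.dom := (inf_le_right : (mul p q).dom ⊓ (mul p r).dom ≤ _) hx
    exact p.left_add _ (q.left_mem le_rfl h1) _ (r.left_mem le_rfl h2)
  right_distrib := by
    rintro ⟨p⟩ ⟨q⟩ ⟨r⟩
    refine Quotient.sound (equiv_of_agree fun x _ hx => ⟨rfl, ?_⟩)
    have h1 : x ∈ idealMul r.dom p.dom := (inf_le_left : (mul p r).dom ⊓ (mul q r).dom ≤ _) hx
    have h2 : x ∈ idealMul r.dom q.dom := (inf_le_right : (mul p r).dom ⊓ (mul q r).dom ≤ _) hx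
    exact r.right_add _ (p.right_mem le_rfl h1) _ (q.right_mem le_rfl h2)
  nsmul := nsmulRec
  zsmul := zsmulRec

end SymmetricQuotient

section Extended

variable (R : Type u) [NonUnitalRing R] [IsPrimeRing R]

/-- The canonical embedding of `R` into `Q_s(R)`. -/
def toQuotient : R →ₙ+* SymmetricQuotient R where
  toFun r := Quotient.mk _ (QuotientRep.ofElem r)
  map_zero' := rfl
  map_add' a b := Quotient.sound (QuotientRep.equiv_of_agree fun x _ _ =>
    ⟨add_mul a b x, mul_add x a b⟩)
  map_mul' a b := Quotient.sound (QuotientRep.equiv_of_agree fun x _ _ =>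
    ⟨mul_assoc a b x, (mul_assoc x a b).symm⟩)

/-- The extended centroid `C` of `R`: the center of `Q_s(R)`. -/
abbrev ExtendedCentroid : Subring (SymmetricQuotient R) :=
  Subring.center (SymmetricQuotient R)

variable {R}

/-- `AC` for a subset `A` of `R`: the `C`-linear span of `A` inside `Q_s(R)`. -/
def centralSpan (A : Set R) : Submodule (ExtendedCentroid R) (SymmetricQuotient R) :=
  Submodule.span (ExtendedCentroid R) (toQuotient R '' A)

variable (R)

/-- A prime ring `R` is exceptional if `char R = 2` and `dim_C RC = 4`. The characteristic of a
ring which need not be unital is the exponent of its additive group (`0` if there is none). -/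
def IsExceptional : Prop :=
  AddMonoid.exponent R = 2 ∧
    Module.finrank (ExtendedCentroid R) (centralSpan (Set.univ : Set R)) = 4

end Extended

end PrimeLie

/-! Suppose two noncentral Lie ideals `K`, `L` commute. For `a ∈ K` and a noncentral `b ∈ L`, `[a,
[b, x]] = 0` for all `x`. Expanding this with the derivations `[a, ·]` and `[b, ·]` yields a
Martindale identity, hence `a = lb + k` with `l, k ∈ C` and `2l = 0`. A noncentral `a` has `l ≠ 0`,
so the characteristic is two, `b² ∈ C`, and `K`, `L` and `[b, R]` all lie in the commutative ring
`Cb + C` (`isInseparable_of_commute`). Some `[b, x]` is invertible; dividing by it shows that `[b,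
·]` on `RC` has both kernel and image `Cb + C`, so `dim RC = 2 + 2` (`rank_centralSpan`). The same
division gives `KC = LC = Cb + C`.

For powers: `K^m` is again a Lie ideal, noncentral if `K` is (`not_isCentral_power`), so the above
applies to `K^m` and `L^n`. It remains to pass from `K^m ⊆ Cb + C` to `K ⊆ Cb + C`
(`mem_affineSpan_of_power`): either `K` centralizes `b`, or `1 ∈ KC` and one factor `K` can be
removed at a time. -/

namespace PrimeLie

universe u

/-! ### The symmetric ring of quotients, Martindale's lemma, and the field `C`. -/

section Quotient

variable {R : Type u} [NonUnitalRing R] [IsPrimeRing R]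

theorem eq_zero_of_forall_mul_right {a : R} {J : TwoSidedIdeal R} (hJ : J ≠ ⊥)
    (h : ∀ x ∈ J, a * x = 0) : a = 0 := by
  obtain ⟨y, hy, hy0⟩ := exists_mem_ne_zero hJ
  refine (IsPrimeRing.eq_zero_or_eq_zero a y fun r => ?_).resolve_right hy0
  rw [mul_assoc]
  exact h _ (J.mul_mem_left _ _ hy)

theorem eq_zero_of_forall_mul_left {a : R} {J : TwoSidedIdeal R} (hJ : J ≠ ⊥)
    (h : ∀ x ∈ J, x * a = 0) : a = 0 := by
  obtain ⟨y, hy, hy0⟩ := exists_mem_ne_zero hJ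
  exact (IsPrimeRing.eq_zero_or_eq_zero y a fun r => h _ (J.mul_mem_right _ _ hy)).resolve_left hy0

/-- The element of `Q_s(R)` with a given representative. -/
def SymmetricQuotient.mk (p : QuotientRep R) : SymmetricQuotient R :=
  Quotient.mk _ p

theorem SymmetricQuotient.exists_mk_eq (q : SymmetricQuotient R) :
    ∃ p : QuotientRep R, mk p = q :=
  Quotient.exists_rep q

theorem toQuotient_injective : Function.Injective (toQuotient R) := by
  refine (injective_iff_map_eq_zero _).2 fun r hr => ?_
  obtain ⟨J, hJ, -, -, h⟩ := 
    Quotient.exact (hr : Quotient.mk _ (QuotientRep.ofElem r) = Quotient.mk _ (QuotientRep.ofElem 0))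
  exact eq_zero_of_forall_mul_right hJ fun x hx => ((h x hx).1 : r * x = 0 * x).trans (zero_mul x)

/-- On left maps this is right linearity of `p.left`; on right maps it is `compat`. It allows
computing in the ring `Q_s(R)` instead of with representatives. -/
theorem mk_mul_toQuotient (p : QuotientRep R) {x : R} (hx : x ∈ p.dom) :
    SymmetricQuotient.mk p * toQuotient R x = toQuotient R (p.left x) := by
  refine Quotient.sound (QuotientRep.equiv_of_agree
    (p := .mul p (.ofElem x)) (q := .ofElem (p.left x)) fun y hy _ => ⟨p.left_mul x hx y, ?_⟩)
  exact p.compat y (idealMul_le_right hy) x hx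

theorem toQuotient_mul_mk (p : QuotientRep R) {x : R} (hx : x ∈ p.dom) :
    toQuotient R x * SymmetricQuotient.mk p = toQuotient R (p.right x) := by
  refine Quotient.sound (QuotientRep.equiv_of_agree
    (p := .mul (.ofElem x) p) (q := .ofElem (p.right x)) fun y hy _ => ⟨?_, p.right_mul x hx y⟩)
  exact (p.compat x hx y (idealMul_le_left hy)).symm

/-- Every element of `Q_s(R)` multiplies some nonzero ideal of `R` into `R`, on both sides. -/
theorem exists_ideal_mul_mem (q : SymmetricQuotient R) : ∃ J : TwoSidedIdeal R, J ≠ ⊥ ∧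
    ∀ x ∈ J, (∃ y, q * toQuotient R x = toQuotient R y) ∧
      ∃ y, toQuotient R x * q = toQuotient R y := by
  obtain ⟨p, rfl⟩ := q.exists_mk_eq
  exact ⟨p.dom, p.dom_ne_bot, fun x hx =>
    ⟨⟨_, mk_mul_toQuotient p hx⟩, ⟨_, toQuotient_mul_mk p hx⟩⟩⟩

/-- The left map vanishes on `J ⊓ p.dom` directly; then `(xq)y = x(qy) = 0` and primeness kill the
right map. -/
theorem eq_zero_of_forall_mul_toQuotient {q : SymmetricQuotient R} {J : TwoSidedIdeal R}
    (hJ : J ≠ ⊥) (h : ∀ x ∈ J, q * toQuotient R x = 0) : q = 0 := by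
  obtain ⟨p, rfl⟩ := q.exists_mk_eq
  have hl : ∀ x ∈ J ⊓ p.dom, p.left x = 0 := fun x hx => by
    have hx' : x ∈ p.dom := (inf_le_right : J ⊓ p.dom ≤ _) hx
    refine toQuotient_injective ?_
    rw [← mk_mul_toQuotient p hx', map_zero]
    exact h x ((inf_le_left : J ⊓ p.dom ≤ _) hx)
  refine Quotient.sound ⟨J ⊓ p.dom, inf_ne_bot hJ p.dom_ne_bot, inf_le_right, le_top,
    fun x hx => ⟨(hl x hx).trans (zero_mul x).symm, ?_⟩⟩
  refine Eq.trans ?_ (mul_zero x).symm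
  refine eq_zero_of_forall_mul_right (inf_ne_bot hJ p.dom_ne_bot) fun y hy => ?_
  rw [p.compat x ((inf_le_right : J ⊓ p.dom ≤ _) hx) y ((inf_le_right : J ⊓ p.dom ≤ _) hy),
    hl y hy, mul_zero]

theorem eq_zero_of_forall_toQuotient_mul {q : SymmetricQuotient R} {J : TwoSidedIdeal R}
    (hJ : J ≠ ⊥) (h : ∀ x ∈ J, toQuotient R x * q = 0) : q = 0 := by
  obtain ⟨I, hI, hq⟩ := exists_ideal_mul_mem q
  refine eq_zero_of_forall_mul_toQuotient hI fun x hx => ?_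
  obtain ⟨y, hy⟩ := (hq x hx).1
  rw [hy, ← map_zero (toQuotient R)]
  congr 1
  refine eq_zero_of_forall_mul_left hJ fun z hz => toQuotient_injective ?_
  rw [map_mul, ← hy, ← mul_assoc, h z hz, zero_mul, map_zero]

/-- Primeness of `R` carries over: with `px = a` and `yq = b` in `R`, `arb = p(xry)q = 0`. -/
theorem eq_zero_or_eq_zero_of_forall_mul {p q : SymmetricQuotient R}
    (h : ∀ x, p * toQuotient R x * q = 0) : p = 0 ∨ q = 0 := by
  by_contra! hpq
  obtain ⟨I, hI, hp⟩ := exists_ideal_mul_mem p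
  obtain ⟨J, hJ, hq⟩ := exists_ideal_mul_mem q
  refine hpq.1 (eq_zero_of_forall_mul_toQuotient hI fun x hx => ?_)
  by_contra hx0
  refine hpq.2 (eq_zero_of_forall_toQuotient_mul hJ fun y hy => ?_)
  obtain ⟨a, ha⟩ := (hp x hx).1
  obtain ⟨b, hb⟩ := (hq y hy).2
  have : a = 0 ∨ b = 0 := IsPrimeRing.eq_zero_or_eq_zero a b fun r => toQuotient_injective (by
    rw [map_mul, map_mul, ← ha, ← hb, map_zero, ← zero_mul (1 : SymmetricQuotient R),
      ← h (x * r * y)]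
    simp only [map_mul, mul_assoc, mul_one])
  rcases this with rfl | rfl
  · exact (hx0 (by simpa using ha)).elim
  · simpa using hb

theorem mem_center_of_forall_commute {q : SymmetricQuotient R}
    (h : ∀ x, toQuotient R x * q = q * toQuotient R x) :
    q ∈ Subring.center (SymmetricQuotient R) := by
  refine Subring.mem_center_iff.2 fun p => sub_eq_zero.1 ?_
  obtain ⟨J, hJ, hp⟩ := exists_ideal_mul_mem p
  refine eq_zero_of_forall_mul_toQuotient hJ fun x hx => ?_
  obtain ⟨y, hy⟩ := (hp x hx).1
  rw [sub_mul, mul_assoc, ← h, ← mul_assoc, hy, h, mul_assoc, hy, sub_self]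

theorem toQuotient_mem_center {a : R} :
    toQuotient R a ∈ Subring.center (SymmetricQuotient R) ↔ a ∈ NonUnitalSubring.center R := by
  refine ⟨fun h => NonUnitalSubring.mem_center_iff.2 fun x => toQuotient_injective ?_,
    fun h => mem_center_of_forall_commute fun x => ?_⟩
  · rw [map_mul, map_mul, Subring.mem_center_iff.1 h]
  · rw [← map_mul, ← map_mul, NonUnitalSubring.mem_center_iff.1 h]

open Classical in
/-- If `a x c = b x a` for all `x`, then `b` is a multiple of `a` by the extended centroid. -/
theorem exists_center_mul_eq_of_ring {a b c : R} (ha : a ≠ 0)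
    (h : ∀ x, a * x * c = b * x * a) :
    ∃ l : ExtendedCentroid R, toQuotient R b = l • toQuotient R a := by
  have uniq : ∀ {z z' : R}, (∀ x, z * x * a = z' * x * a) → z = z' := fun {z z'} hz =>
    sub_eq_zero.1 ((IsPrimeRing.eq_zero_or_eq_zero (z - z') a fun r => by
      rw [sub_mul, sub_mul, hz, sub_self]).resolve_right ha)
  -- The sought scalar `l` should satisfy `c = la`, so `z = ly` is characterized by `zxa = yxc`. By
  -- `uniq` this makes `y ↦ z` a bimodule map on `J`, usable as both the left and the right map; `a
  -- ∈ J` is sent to `b`.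
  let J : TwoSidedIdeal R := TwoSidedIdeal.mk' {y | ∃ z, ∀ x, z * x * a = y * x * c}
    ⟨0, fun x => by simp⟩
    (by rintro y y' ⟨z, hz⟩ ⟨z', hz'⟩; exact ⟨z + z', fun x => by simp only [add_mul, hz, hz']⟩)
    (by rintro y ⟨z, hz⟩; exact ⟨-z, fun x => by simp only [neg_mul, hz]⟩)
    (by rintro r y ⟨z, hz⟩; exact ⟨r * z, fun x => by rw [mul_assoc, mul_assoc, ← mul_assoc z, hz]; simp only [mul_assoc]⟩)
    (by
      rintro y r ⟨z, hz⟩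
      exact ⟨z * r, fun x => by rw [mul_assoc z, hz, mul_assoc y r]⟩)
  have hJ : ∀ {y}, y ∈ J ↔ ∃ z, ∀ x, z * x * a = y * x * c := by
    intro y; simp [J]
  have haJ : a ∈ J := hJ.2 ⟨b, fun x => (h x).symm⟩
  let f : R → R := fun y => if hy : ∃ z, ∀ x, z * x * a = y * x * c then hy.choose else 0
  have hf : ∀ y ∈ J, ∀ x, f y * x * a = y * x * c := fun y hy => by
    have hy' := hJ.1 hy
    simp only [f, dif_pos hy']
    exact hy'.choose_spec
  have hadd : ∀ x ∈ J, ∀ y ∈ J, f (x + y) = f x + f y := fun x hx y hy => uniq fun w => by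
    rw [hf _ (J.add_mem hx hy), add_mul, add_mul, add_mul, add_mul, hf x hx, hf y hy]
  have hmr : ∀ x ∈ J, ∀ r, f (x * r) = f x * r := fun x hx r => uniq fun w => by
    rw [hf _ (J.mul_mem_right _ _ hx), mul_assoc (f x), hf x hx, mul_assoc x]
  have hml : ∀ x ∈ J, ∀ r, f (r * x) = r * f x := fun x hx r => uniq fun w => by
    rw [hf _ (J.mul_mem_left _ _ hx), mul_assoc r, mul_assoc r, mul_assoc r, mul_assoc r, hf x hx]
  let p : QuotientRep R :=
    { dom := J
      dom_ne_bot := ne_bot_of_mem haJ ha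
      left := f
      right := f
      left_add := hadd
      left_mul := hmr
      right_add := hadd
      right_mul := hml
      compat := fun x hx y hy => (hmr x hx y).symm.trans (hml y hy x) }
  have hp : SymmetricQuotient.mk p ∈ Subring.center (SymmetricQuotient R) := by
    refine mem_center_of_forall_commute fun r => sub_eq_zero.1 ?_
    refine eq_zero_of_forall_mul_toQuotient (J := J) (ne_bot_of_mem haJ ha) fun x hx => ?_
    rw [sub_mul, mul_assoc, mul_assoc, mk_mul_toQuotient p hx, ← map_mul, ← map_mul,
      mk_mul_toQuotient p (J.mul_mem_left _ _ hx), sub_eq_zero]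
    exact congrArg _ (hml x hx r).symm
  refine ⟨⟨_, hp⟩, ?_⟩
  refine Eq.trans ?_ (mk_mul_toQuotient p haJ).symm
  exact congrArg (toQuotient R) (uniq fun x => (h x).symm.trans (hf a haJ x).symm)

/-- Left multiplication by a suitable `s ∈ R` with `sa ≠ 0` moves `a`, `b`, `c` into `R`, where the
previous lemma gives `sb = l(sa)`. Primeness then cancels the outer factors, giving first `c = la`,
then `b = la`. -/
theorem exists_smul_eq {a b c : SymmetricQuotient R} (ha : a ≠ 0)
    (h : ∀ x, a * toQuotient R x * c = b * toQuotient R x * a) :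
    ∃ l : ExtendedCentroid R, b = l • a ∧ c = l • a := by
  obtain ⟨I, hI, hIa⟩ := exists_ideal_mul_mem a
  obtain ⟨J, hJ, hJb⟩ := exists_ideal_mul_mem b
  obtain ⟨K, hK, hKc⟩ := exists_ideal_mul_mem c
  have hIJK := inf_ne_bot (inf_ne_bot hI hJ) hK
  obtain ⟨s, hs, hs0⟩ : ∃ s ∈ I ⊓ J ⊓ K, toQuotient R s * a ≠ 0 := by
    by_contra! hs
    exact ha (eq_zero_of_forall_toQuotient_mul hIJK hs)
  have hsI : s ∈ I := (inf_le_left.trans inf_le_left : I ⊓ J ⊓ K ≤ I) hs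
  have hsJ : s ∈ J := (inf_le_left.trans inf_le_right : I ⊓ J ⊓ K ≤ J) hs
  have hsK : s ∈ K := (inf_le_right : I ⊓ J ⊓ K ≤ K) hs
  obtain ⟨a', ha'⟩ := (hIa s hsI).2
  obtain ⟨b', hb'⟩ := (hJb s hsJ).2
  obtain ⟨c', hc'⟩ := (hKc s hsK).2
  have ha0 : a' ≠ 0 := by
    rintro rfl
    exact hs0 (ha'.trans (map_zero _))
  obtain ⟨l, hl⟩ := exists_center_mul_eq_of_ring (a := a') (b := b') (c := c') ha0 fun x => by
    refine toQuotient_injective ?_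
    have := congrArg (toQuotient R s * ·) (h (x * s))
    simp only [map_mul, ← ha', ← hb', ← hc', mul_assoc] at this ⊢
    exact this
  have hcl : c = l • a := by
    refine sub_eq_zero.1 ((eq_zero_or_eq_zero_of_forall_mul (p := toQuotient R s * a)
      fun x => ?_).resolve_left hs0)
    have := congrArg (toQuotient R s * ·) (h x)
    simp only [← mul_assoc] at this
    rw [mul_sub, this, hb', hl, mul_smul_comm, ha', smul_mul_assoc, smul_mul_assoc, sub_self]
  refine ⟨l, sub_eq_zero.1 ((eq_zero_or_eq_zero_of_forall_mul (q := a) fun x => ?_).resolve_right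
    ha), hcl⟩
  rw [sub_mul, sub_mul, ← h x, hcl, mul_smul_comm, smul_mul_assoc, smul_mul_assoc, sub_self]

instance : Nontrivial (SymmetricQuotient R) := by
  obtain ⟨x, hx⟩ := exists_ne (0 : R)
  exact ⟨toQuotient R x, 0, fun h => hx (toQuotient_injective (h.trans (map_zero _).symm))⟩

/-- Since `l` is central, `l·x·1 = 1·x·l`, and Martindale's lemma writes `1` as a multiple of `l`.
-/
theorem isUnit_or_eq_zero (l : ExtendedCentroid R) : IsUnit l ∨ l = 0 := by
  refine or_iff_not_imp_right.2 fun hl => ?_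
  have hl0 : (l : SymmetricQuotient R) ≠ 0 := fun h => hl (Subtype.ext h)
  obtain ⟨k, hk, -⟩ := exists_smul_eq (a := (l : SymmetricQuotient R)) (b := 1) (c := 1) hl0
    fun x => by rw [mul_one, one_mul, Subring.mem_center_iff.1 l.2]
  exact IsUnit.of_mul_eq_one_right k (Subtype.ext hk.symm)

/-- The extended centroid is a field. -/
noncomputable abbrev extendedCentroidField : Field (ExtendedCentroid R) :=
  Field.ofIsUnitOrEqZero isUnit_or_eq_zero

end Quotient

/-! ### Powers of Lie ideals. -/

section Power

variable {R : Type u} [NonUnitalRing R]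

theorem isLieIdeal_iff {L : AddSubgroup R} :
    IsLieIdeal L ↔ ∀ a ∈ L, ∀ x, a * x - x * a ∈ L := by
  refine (AddSubgroup.closure_le L).trans ⟨fun h a ha x => h ⟨a, ha, x, trivial, rfl⟩, ?_⟩
  rintro h _ ⟨a, ha, x, -, rfl⟩
  exact h a ha x

theorem commutator_eq_bot_iff {A B : Set R} :
    commutator A B = ⊥ ↔ ∀ a ∈ A, ∀ b ∈ B, a * b = b * a := by
  refine eq_bot_iff.trans ((AddSubgroup.closure_le _).trans ⟨fun h a ha b hb => ?_, ?_⟩)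
  · exact sub_eq_zero.1 (h ⟨a, ha, b, hb, rfl⟩)
  · rintro h _ ⟨a, ha, b, hb, rfl⟩
    exact sub_eq_zero.2 (h a ha b hb)

theorem power_one (K : AddSubgroup R) : power (K : Set R) 1 = K :=
  AddSubgroup.closure_eq K

theorem power_succ (A : Set R) {m : ℕ} (hm : 1 ≤ m) :
    power A (m + 1) = product (power A m : Set R) A := by
  obtain ⟨m, rfl⟩ := Nat.exists_eq_add_of_le' hm
  rfl

theorem mul_mem_power {A : Set R} {m : ℕ} (hm : 1 ≤ m) {w a : R} (hw : w ∈ power A m)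
    (ha : a ∈ A) : w * a ∈ power A (m + 1) := by
  rw [power_succ A hm]
  exact AddSubgroup.subset_closure ⟨w, hw, a, ha, rfl⟩

theorem power_succ_le {A : Set R} {m : ℕ} (hm : 1 ≤ m) {P : AddSubgroup R}
    (h : ∀ w ∈ power A m, ∀ a ∈ A, w * a ∈ P) : power A (m + 1) ≤ P := by
  rw [power_succ A hm]
  refine (AddSubgroup.closure_le P).2 ?_
  rintro _ ⟨w, hw, a, ha, rfl⟩
  exact h w hw a ha

theorem mul_mem_power' {K : AddSubgroup R} {m : ℕ} (hm : 1 ≤ m) {a : R} (ha : a ∈ K) :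
    ∀ w ∈ power (K : Set R) m, a * w ∈ power (K : Set R) (m + 1) := by
  induction m, hm using Nat.le_induction with
  | base =>
    intro w hw
    rw [power_one] at hw
    exact mul_mem_power le_rfl ((power_one K).symm ▸ ha) hw
  | succ m hm ih =>
    refine power_succ_le (P := (power (K : Set R) (m + 1 + 1)).comap (AddMonoidHom.mulLeft a)) hm
      fun w hw b hb => ?_
    have := mul_mem_power (hm.trans m.le_succ) (ih w hw) hb
    rwa [mul_assoc] at this

/-- Leibniz rule: `[wb, x] = w[b, x] + [w, x]b`. -/
theorem isLieIdeal_power {K : AddSubgroup R} (hK : IsLieIdeal K) {m : ℕ} (hm : 1 ≤ m) :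
    IsLieIdeal (power (K : Set R) m) := by
  induction m, hm using Nat.le_induction with
  | base => rwa [power_one]
  | succ m hm ih =>
    rw [isLieIdeal_iff] at ih hK ⊢
    intro a ha x
    let P : AddSubgroup R := (power (K : Set R) (m + 1)).comap
      ((AddMonoidHom.mulRight x : R →+ R) - AddMonoidHom.mulLeft x)
    refine power_succ_le (P := P) hm (fun w hw b hb => ?_) ha
    have h : w * b * x - x * (w * b) = w * (b * x - x * b) + (w * x - x * w) * b := by
      noncomm_ring
    change w * b * x - x * (w * b) ∈ power (K : Set R) (m + 1)
    rw [h]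
    exact add_mem (mul_mem_power hm hw (hK b hb x)) (mul_mem_power hm (ih w hw x) hb)

theorem commute_of_mem_power {K : AddSubgroup R} {y : R} (h : ∀ a ∈ K, a * y = y * a) {m : ℕ}
    (hm : 1 ≤ m) : ∀ w ∈ power (K : Set R) m, w * y = y * w := by
  induction m, hm using Nat.le_induction with
  | base => rwa [power_one]
  | succ m hm ih =>
    intro w hw
    let P : AddSubgroup R := ((AddMonoidHom.mulRight y : R →+ R) - AddMonoidHom.mulLeft y).ker
    refine sub_eq_zero.1 (power_succ_le (P := P) hm (fun w hw b hb => sub_eq_zero.2 ?_) hw)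
    change w * b * y = y * (w * b)
    rw [mul_assoc, h b hb, ← mul_assoc, ih w hw, mul_assoc]

variable [IsPrimeRing R]

/-- From `w[a, x] = 0` and `wa = 0` follows `wxa = 0`, so primeness applies. -/
theorem eq_zero_of_forall_mul_lieIdeal {K : AddSubgroup R} (hK : IsLieIdeal K)
    (hKZ : ¬ IsCentral K) {w : R} (hw : ∀ a ∈ K, w * a = 0) : w = 0 := by
  by_contra hw0
  refine hKZ fun a ha => ?_
  rw [(IsPrimeRing.eq_zero_or_eq_zero w a fun x => ?_).resolve_left hw0]
  · exact zero_mem _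
  · have := hw _ (isLieIdeal_iff.1 hK a ha x)
    rwa [mul_sub, ← mul_assoc, hw a ha, zero_mul, zero_sub, neg_eq_zero, ← mul_assoc] at this

theorem exists_mem_power_ne_zero {K : AddSubgroup R} (hK : IsLieIdeal K)
    (hKZ : ¬ IsCentral K) {m : ℕ} (hm : 1 ≤ m) : ∃ w ∈ power (K : Set R) m, w ≠ 0 := by
  induction m, hm using Nat.le_induction with
  | base =>
    by_contra! h
    rw [power_one] at h
    exact hKZ fun a ha => h a ha ▸ zero_mem _
  | succ m hm ih =>
    obtain ⟨w, hw, hw0⟩ := ih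
    by_contra! h
    exact hw0 (eq_zero_of_forall_mul_lieIdeal hK hKZ fun a ha => h _ (mul_mem_power hm hw ha))

end Power

/-! ### The subspaces `Cb + C`. -/

section Quadratic

variable {R : Type u} [NonUnitalRing R] [IsPrimeRing R]

attribute [local instance] extendedCentroidField

/-- The subspace `Cb + C` of `Q_s(R)`. -/
noncomputable abbrev affineSpan (b : SymmetricQuotient R) :
    Submodule (ExtendedCentroid R) (SymmetricQuotient R) :=
  Submodule.span (ExtendedCentroid R) {b, 1}

theorem mem_affineSpan {b q : SymmetricQuotient R} :
    q ∈ affineSpan b ↔ ∃ l k : ExtendedCentroid R, l • b + k • (1 : SymmetricQuotient R) = q :=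
  Submodule.mem_span_pair

theorem smul_one_mem_center (l : ExtendedCentroid R) :
    l • (1 : SymmetricQuotient R) ∈ Subring.center (SymmetricQuotient R) := by
  rw [Subring.smul_def, smul_eq_mul, mul_one]
  exact l.2

theorem exists_smul_one_eq {q : SymmetricQuotient R}
    (hq : q ∈ Subring.center (SymmetricQuotient R)) :
    ∃ l : ExtendedCentroid R, l • (1 : SymmetricQuotient R) = q :=
  ⟨⟨q, hq⟩, by rw [Subring.smul_def, smul_eq_mul, mul_one]⟩

theorem left_mem_affineSpan (b : SymmetricQuotient R) : b ∈ affineSpan b :=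
  Submodule.subset_span (by simp)

theorem one_mem_affineSpan (b : SymmetricQuotient R) : 1 ∈ affineSpan b :=
  Submodule.subset_span (by simp)

theorem mem_affineSpan_of_mem_center {b q : SymmetricQuotient R}
    (hq : q ∈ Subring.center (SymmetricQuotient R)) : q ∈ affineSpan b := by
  obtain ⟨l, rfl⟩ := exists_smul_one_eq hq
  exact Submodule.smul_mem _ _ (one_mem_affineSpan b)

theorem affineSpan_commute {b p q : SymmetricQuotient R} (hp : p ∈ affineSpan b)
    (hq : q ∈ affineSpan b) : p * q = q * p := by
  obtain ⟨l, k, rfl⟩ := mem_affineSpan.1 hp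
  obtain ⟨l', k', rfl⟩ := mem_affineSpan.1 hq
  simp only [mul_add, add_mul, smul_mul_assoc, mul_smul_comm, mul_one, one_mul]
  module

theorem mem_affineSpan_comm {a b : SymmetricQuotient R}
    (ha : a ∉ Subring.center (SymmetricQuotient R)) (h : a ∈ affineSpan b) :
    b ∈ affineSpan a := by
  obtain ⟨l, k, rfl⟩ := mem_affineSpan.1 h
  have hl : l ≠ 0 := by
    rintro rfl
    exact ha (by simpa using smul_one_mem_center k)
  refine mem_affineSpan.2 ⟨l⁻¹, -(l⁻¹ * k), ?_⟩
  rw [smul_add, smul_smul, smul_smul, inv_mul_cancel₀ hl]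
  module

theorem affineSpan_le {a b : SymmetricQuotient R} (h : a ∈ affineSpan b) :
    affineSpan a ≤ affineSpan b :=
  Submodule.span_le.2 (Set.insert_subset h (by simpa using one_mem_affineSpan b))

theorem affineSpan_eq {a b : SymmetricQuotient R}
    (ha : a ∉ Subring.center (SymmetricQuotient R)) (h : a ∈ affineSpan b) :
    affineSpan a = affineSpan b :=
  le_antisymm (affineSpan_le h) (affineSpan_le (mem_affineSpan_comm ha h))

/-! ### Commuting Lie ideals. -/

/-- If `[a, [b, R]] = 0` and `b` is not central, then `a` lies in `Cb + C`, and moreover twice the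
coefficient of `b` vanishes. -/
theorem exists_eq_of_commute_commutator {a b : SymmetricQuotient R}
    (hb : b ∉ Subring.center (SymmetricQuotient R))
    (h : ∀ x, a * (b * toQuotient R x - toQuotient R x * b) =
      (b * toQuotient R x - toQuotient R x * b) * a) :
    ∃ l k : ExtendedCentroid R, 2 * l = 0 ∧ a = l • b + k • (1 : SymmetricQuotient R) := by
  have key : ∀ x y z, (b * toQuotient R x - toQuotient R x * b) * toQuotient R y *
        -(a * toQuotient R z - toQuotient R z * a) =
      (a * toQuotient R x - toQuotient R x * a) * toQuotient R y *
        (b * toQuotient R z - toQuotient R z * b) := by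
    -- Apply `[a, [b, ·]] = 0` to the product `xy`. Replacing `y` by `yz` in the result then yields
    -- `key`.
    have two : ∀ x y, (a * toQuotient R x - toQuotient R x * a) *
          (b * toQuotient R y - toQuotient R y * b) +
        (b * toQuotient R x - toQuotient R x * b) *
          (a * toQuotient R y - toQuotient R y * a) = 0 := by
      intro x y
      have h1 := sub_eq_zero.2 (h (x * y))
      have h2 := sub_eq_zero.2 (h x)
      have h3 := sub_eq_zero.2 (h y)
      simp only [map_mul] at h1
      generalize toQuotient R x = x at *
      generalize toQuotient R y = y at *
      calc _ = (a * (b * (x * y) - x * y * b) - (b * (x * y) - x * y * b) * a) -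
            (a * (b * x - x * b) - (b * x - x * b) * a) * y -
            x * (a * (b * y - y * b) - (b * y - y * b) * a) := by noncomm_ring
        _ = 0 := by rw [h1, h2, h3]; simp
    intro x y z
    have h1 := two x (y * z)
    have h2 := two x y
    simp only [map_mul] at h1
    generalize toQuotient R x = x at *
    generalize toQuotient R y = y at *
    generalize toQuotient R z = z at *
    rw [← sub_eq_zero]
    calc _ = ((a * x - x * a) * (b * y - y * b) + (b * x - x * b) * (a * y - y * a)) * z -
          ((a * x - x * a) * (b * (y * z) - y * z * b) +
            (b * x - x * b) * (a * (y * z) - y * z * a)) := by noncomm_ring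
      _ = 0 := by rw [h1, h2]; simp
  obtain ⟨x, hx⟩ : ∃ x, b * toQuotient R x - toQuotient R x * b ≠ 0 := by
    by_contra! hx
    exact hb (mem_center_of_forall_commute fun x => (sub_eq_zero.1 (hx x)).symm)
  -- With `z = x`, Martindale's lemma makes both `[a, x]` and `-[a, x]` equal to `l[b, x]`, hence
  -- `2l = 0`.
  obtain ⟨l, hl, hl'⟩ := exists_smul_eq hx fun y => key x y x
  have h2l : 2 * l = 0 := by
    have h2 : (2 * l) • (b * toQuotient R x - toQuotient R x * b) = 0 := by
      rw [two_mul, add_smul]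
      nth_rw 1 [← hl]
      rw [← hl']
      exact add_neg_cancel _
    exact (smul_eq_zero.1 h2).resolve_right hx
  have hneg : -l = l := by
    rw [neg_eq_iff_add_eq_zero, ← two_mul, h2l]
  have hcen : a - l • b ∈ Subring.center (SymmetricQuotient R) := by
    refine mem_center_of_forall_commute fun z => sub_eq_zero.1 ?_
    refine (eq_zero_or_eq_zero_of_forall_mul fun y => ?_).resolve_left hx
    have hk := key x y z
    have hl2 : a * toQuotient R x - toQuotient R x * a =
        (-l) • (b * toQuotient R x - toQuotient R x * b) := by rw [hneg, hl]
    rw [hl2, smul_mul_assoc, smul_mul_assoc, ← mul_smul_comm, ← sub_eq_zero, ← mul_sub] at hk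
    rw [← hk]
    congr 1
    simp only [mul_sub, sub_mul, mul_smul_comm, smul_mul_assoc, neg_smul, smul_sub]
    abel
  obtain ⟨k, hk⟩ := exists_smul_one_eq hcen
  exact ⟨l, k, h2l, by rw [hk]; abel⟩

variable (R) in
/-- `b` is a noncentral element of `R` with `b² ∈ C`, `[b, R] ⊆ Cb + C`, in characteristic two. -/
structure IsInseparable (b : SymmetricQuotient R) : Prop where
  two_eq_zero : (2 : SymmetricQuotient R) = 0
  mem_range : ∃ a, toQuotient R a = b
  notMem_center : b ∉ Subring.center (SymmetricQuotient R)
  mul_self_mem : b * b ∈ Subring.center (SymmetricQuotient R)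
  commutator_mem : ∀ x, b * toQuotient R x - toQuotient R x * b ∈ affineSpan b

/-- Two noncentral Lie ideals which commute lie in `Cb + C` for every noncentral `b` in one of
them. -/
theorem isInseparable_of_commute {K L : AddSubgroup R} (hL : IsLieIdeal L)
    (hK : IsLieIdeal K) (hKZ : ¬ IsCentral K) (h : ∀ a ∈ K, ∀ b ∈ L, a * b = b * a) {b : R}
    (hb : b ∈ L) (hbZ : b ∉ NonUnitalSubring.center R) :
    IsInseparable R (toQuotient R b) ∧ (∀ a ∈ K, toQuotient R a ∈ affineSpan (toQuotient R b)) ∧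
      ∀ a ∈ L, toQuotient R a ∈ affineSpan (toQuotient R b) := by
  have hcomm : ∀ {K L : AddSubgroup R}, IsLieIdeal L → (∀ a ∈ K, ∀ b ∈ L, a * b = b * a) →
      ∀ a ∈ K, ∀ b ∈ L, b ∉ NonUnitalSubring.center R → ∃ l k : ExtendedCentroid R, 2 * l = 0 ∧
        toQuotient R a = l • toQuotient R b + k • (1 : SymmetricQuotient R) := by
    intro K L hL h a ha b hb hbZ
    refine exists_eq_of_commute_commutator (fun hc => hbZ (toQuotient_mem_center.1 hc)) fun x => ?_
    simp only [← map_mul, ← map_sub]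
    rw [h a ha _ (isLieIdeal_iff.1 hL b hb x)]
  have hbC : toQuotient R b ∉ Subring.center (SymmetricQuotient R) :=
    fun hc => hbZ (toQuotient_mem_center.1 hc)
  have hKb : ∀ a ∈ K, toQuotient R a ∈ affineSpan (toQuotient R b) := fun a ha => by
    obtain ⟨l, k, -, hlk⟩ := hcomm hL h a ha b hb hbZ
    exact mem_affineSpan.2 ⟨l, k, hlk.symm⟩
  obtain ⟨a, ha, haZ⟩ : ∃ a ∈ K, a ∉ NonUnitalSubring.center R := by
    by_contra! hc
    exact hKZ hc
  have haC : toQuotient R a ∉ Subring.center (SymmetricQuotient R) :=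
    fun hc => haZ (toQuotient_mem_center.1 hc)
  -- Elements of `L` need not visibly commute with `b`, but they commute with `a ∈ K`, and `Ca + C =
  -- Cb + C`.
  have hLb : ∀ c ∈ L, toQuotient R c ∈ affineSpan (toQuotient R b) := fun c hc => by
    obtain ⟨l, k, -, hlk⟩ := hcomm hK (fun x hx y hy => (h y hy x hx).symm) c hc a ha haZ
    rw [← affineSpan_eq haC (hKb a ha)]
    exact mem_affineSpan.2 ⟨l, k, hlk.symm⟩
  have hcb : ∀ x, toQuotient R b * toQuotient R x - toQuotient R x * toQuotient R b ∈
      affineSpan (toQuotient R b) := fun x => by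
    simp only [← map_mul, ← map_sub]
    exact hLb _ (isLieIdeal_iff.1 hL b hb x)
  obtain ⟨l, k, hl, hlk⟩ := hcomm hL h a ha b hb hbZ
  have hl0 : l ≠ 0 := by
    rintro rfl
    exact haC (by rw [hlk, zero_smul, zero_add]; exact smul_one_mem_center k)
  have h2 : (2 : SymmetricQuotient R) = 0 :=
    congrArg Subtype.val ((mul_eq_zero.1 hl).resolve_right hl0)
  refine ⟨⟨h2, ⟨b, rfl⟩, hbC, mem_center_of_forall_commute fun x => sub_eq_zero.1 ?_, hcb⟩, hKb, hLb⟩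
  have hx := affineSpan_commute (left_mem_affineSpan _) (hcb x)
  rw [← sub_eq_zero] at hx
  generalize toQuotient R b = b at *
  generalize toQuotient R x = x at *
  -- In characteristic two, `[b, [b, x]] = [b², x]`.
  calc _ = b * (b * x - x * b) - (b * x - x * b) * b - 2 * (b * b * x - b * x * b) := by
        noncomm_ring
    _ = 0 := by rw [hx, h2]; simp

/-! ### The algebra `RC` and its inner derivations. -/

theorem toQuotient_mem_centralSpan {A : Set R} {a : R} (ha : a ∈ A) :
    toQuotient R a ∈ centralSpan A :=
  Submodule.subset_span ⟨a, ha, rfl⟩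

theorem centralSpan_le {A : Set R} {W : Submodule (ExtendedCentroid R) (SymmetricQuotient R)} :
    centralSpan A ≤ W ↔ ∀ a ∈ A, toQuotient R a ∈ W :=
  Submodule.span_le.trans Set.forall_mem_image

theorem mul_mem_centralSpan_univ {p q : SymmetricQuotient R}
    (hp : p ∈ centralSpan (Set.univ : Set R)) (hq : q ∈ centralSpan (Set.univ : Set R)) :
    p * q ∈ centralSpan (Set.univ : Set R) := by
  have h : ∀ a : R, centralSpan (Set.univ : Set R) ≤ (centralSpan (Set.univ : Set R)).comap
      (LinearMap.mulLeft (ExtendedCentroid R) (toQuotient R a)) := fun a =>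
    centralSpan_le.2 fun x _ => by
      rw [Submodule.mem_comap, LinearMap.mulLeft_apply, ← map_mul]
      exact toQuotient_mem_centralSpan trivial
  exact (centralSpan_le (W := (centralSpan (Set.univ : Set R)).comap
    (LinearMap.mulRight (ExtendedCentroid R) q))).2 (fun a _ => h a hq) hp

/-- The inner derivation `x ↦ [b, x]` of `Q_s(R)`. -/
noncomputable def innerDerivation (b : SymmetricQuotient R) :
    SymmetricQuotient R →ₗ[ExtendedCentroid R] SymmetricQuotient R :=
  LinearMap.mulLeft _ b - LinearMap.mulRight _ b

theorem innerDerivation_mem {b : SymmetricQuotient R}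
    {W : Submodule (ExtendedCentroid R) (SymmetricQuotient R)}
    (h : ∀ x, b * toQuotient R x - toQuotient R x * b ∈ W) {s : SymmetricQuotient R}
    (hs : s ∈ centralSpan (Set.univ : Set R)) : b * s - s * b ∈ W :=
  (centralSpan_le (W := W.comap (innerDerivation b))).2 (fun x _ => h x) hs

/-! ### The derivation `[b, ·]` for inseparable `b`. -/

namespace IsInseparable

variable {b : SymmetricQuotient R} (hb : IsInseparable R b)

include hb

theorem mem_centralSpan : b ∈ centralSpan (Set.univ : Set R) := by
  obtain ⟨a, rfl⟩ := hb.mem_range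
  exact toQuotient_mem_centralSpan trivial

theorem add_self (q : SymmetricQuotient R) : q + q = 0 := by
  rw [← two_mul, hb.two_eq_zero, zero_mul]

theorem mul_mem {p q : SymmetricQuotient R} (hp : p ∈ affineSpan b) (hq : q ∈ affineSpan b) :
    p * q ∈ affineSpan b := by
  obtain ⟨l, k, rfl⟩ := mem_affineSpan.1 hp
  obtain ⟨l', k', rfl⟩ := mem_affineSpan.1 hq
  have h := mem_affineSpan_of_mem_center (b := b) hb.mul_self_mem
  simp only [mul_add, add_mul, smul_mul_assoc, mul_smul_comm, mul_one, one_mul, smul_add]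
  have h1 := one_mem_affineSpan b
  have h2 := left_mem_affineSpan b
  exact add_mem (add_mem (Submodule.smul_mem _ _ (Submodule.smul_mem _ _ h))
    (Submodule.smul_mem _ _ (Submodule.smul_mem _ _ h2)))
    (add_mem (Submodule.smul_mem _ _ (Submodule.smul_mem _ _ h2))
    (Submodule.smul_mem _ _ (Submodule.smul_mem _ _ h1)))

theorem mul_self_eq (l k : ExtendedCentroid R) :
    (l • b + k • (1 : SymmetricQuotient R)) * (l • b + k • (1 : SymmetricQuotient R)) =
      (l * l) • (b * b) + (k * k) • (1 : SymmetricQuotient R) := by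
  have h := hb.add_self ((l * k) • b)
  simp only [mul_add, add_mul, smul_mul_assoc, mul_smul_comm, mul_one, one_mul, smul_add,
    smul_smul]
  rw [mul_comm k l, add_assoc, ← add_assoc ((l * k) • b), h, zero_add]

theorem mul_self_mem_center {v : SymmetricQuotient R} (hv : v ∈ affineSpan b) :
    v * v ∈ Subring.center (SymmetricQuotient R) := by
  obtain ⟨l, k, rfl⟩ := mem_affineSpan.1 hv
  obtain ⟨c, hc⟩ := exists_smul_one_eq hb.mul_self_mem
  rw [hb.mul_self_eq, ← hc, smul_smul, ← add_smul]
  exact smul_one_mem_center _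

/-- A central `v` with `v² = 0` is zero. Otherwise `w = lv + k`, and in characteristic two `0 = w² =
k²`, so `w ∈ Cv`. -/
theorem mul_eq_zero_of_mul_self_eq_zero {v w : SymmetricQuotient R} (hv : v ∈ affineSpan b)
    (hw : w ∈ affineSpan b) (hv2 : v * v = 0) (hw2 : w * w = 0) : v * w = 0 := by
  by_cases hvC : v ∈ Subring.center (SymmetricQuotient R)
  · rw [(eq_zero_or_eq_zero_of_forall_mul (p := v) (q := v) fun x => by
      rw [← Subring.mem_center_iff.1 hvC, mul_assoc, hv2, mul_zero]).elim id id, zero_mul]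
  · rw [← affineSpan_eq hvC hv] at hw
    obtain ⟨l, k, rfl⟩ := mem_affineSpan.1 hw
    have h := hb.add_self ((l * k) • v)
    simp only [mul_add, add_mul, smul_mul_assoc, mul_smul_comm, mul_one, one_mul, smul_add, smul_smul,
      hv2, smul_zero, zero_add] at hw2
    rw [mul_comm k l, ← add_assoc, h, zero_add] at hw2
    have hk : k = 0 := mul_self_eq_zero.1 ((smul_eq_zero.1 hw2).resolve_right one_ne_zero)
    rw [hk, zero_smul, add_zero, mul_smul_comm, hv2, smul_zero]

/-- Some commutator `[b, x]` is invertible. -/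
theorem exists_commutator_inverse : ∃ x, ∃ l : ExtendedCentroid R,
    (b * toQuotient R x - toQuotient R x * b) * (l • (b * toQuotient R x - toQuotient R x * b)) =
      1 := by
  obtain ⟨x, hx⟩ : ∃ x, (b * toQuotient R x - toQuotient R x * b) *
      (b * toQuotient R x - toQuotient R x * b) ≠ 0 := by
    by_contra! h
    -- Write `d = [b, ·]`. If all `d(x)` square to zero, their products vanish, so `d(y)d(xy) =
    -- d(y)d(x)y + d(y)xd(y)` forces `d(y)xd(y) = 0`.
    have hd : ∀ x, b * toQuotient R x - toQuotient R x * b = 0 := by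
      intro y
      refine (eq_zero_or_eq_zero_of_forall_mul fun x => ?_).elim id id
      have h1 := hb.mul_eq_zero_of_mul_self_eq_zero (hb.commutator_mem y)
        (hb.commutator_mem (x * y)) (h _) (h _)
      have h2 := hb.mul_eq_zero_of_mul_self_eq_zero (hb.commutator_mem y)
        (hb.commutator_mem x) (h _) (h _)
      simp only [map_mul] at h1
      generalize toQuotient R x = x at *
      generalize toQuotient R y = y at *
      calc _ = (b * y - y * b) * (b * (x * y) - x * y * b) -
            (b * y - y * b) * (b * x - x * b) * y := by noncomm_ring
        _ = 0 := by rw [h1, h2]; simp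
    exact hb.notMem_center (mem_center_of_forall_commute fun x => (sub_eq_zero.1 (hd x)).symm)
  obtain ⟨c, hc⟩ := exists_smul_one_eq (hb.mul_self_mem_center (hb.commutator_mem x))
  have hc0 : c ≠ 0 := by
    rintro rfl
    exact hx (by rw [← hc, zero_smul])
  exact ⟨x, c⁻¹, by rw [mul_smul_comm, ← hc, smul_smul, inv_mul_cancel₀ hc0, one_smul]⟩

/-- Here `[b, sx] = s[b, x]` lies in the ring `Cb + C`; choose `x` with `[b, x]` invertible there
and divide. -/
theorem mem_affineSpan_of_commute {s : SymmetricQuotient R}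
    (hs : s ∈ centralSpan (Set.univ : Set R)) (h : b * s = s * b) : s ∈ affineSpan b := by
  obtain ⟨x, l, hl⟩ := hb.exists_commutator_inverse
  have h1 := innerDerivation_mem hb.commutator_mem
    (mul_mem_centralSpan_univ hs (toQuotient_mem_centralSpan (Set.mem_univ x)))
  have h2 : b * (s * toQuotient R x) - s * toQuotient R x * b =
      s * (b * toQuotient R x - toQuotient R x * b) := by
    rw [← mul_assoc, h, mul_sub, mul_assoc, mul_assoc]
  rw [h2] at h1
  have h3 := hb.mul_mem h1 (Submodule.smul_mem _ l (hb.commutator_mem x))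
  rwa [mul_assoc, hl, mul_one] at h3

/-- Though `R` may lack a unit, `1 = v(lv)` for a commutator `v = [b, x]` in `RC`. -/
theorem affineSpan_le_centralSpan : affineSpan b ≤ centralSpan (Set.univ : Set R) := by
  refine Submodule.span_le.2 (Set.insert_subset hb.mem_centralSpan (Set.singleton_subset_iff.2 ?_))
  obtain ⟨x, l, hl⟩ := hb.exists_commutator_inverse
  have hx := toQuotient_mem_centralSpan (Set.mem_univ x)
  have hv := sub_mem (mul_mem_centralSpan_univ hb.mem_centralSpan hx)
    (mul_mem_centralSpan_univ hx hb.mem_centralSpan)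
  rw [SetLike.mem_coe, ← hl]
  exact mul_mem_centralSpan_univ hv (Submodule.smul_mem _ l hv)

/-- With `v = [b, x]` invertible, `tv⁻¹` commutes with `b`, so `[b, tv⁻¹x] = t`. -/
theorem exists_commutator_eq {t : SymmetricQuotient R} (ht : t ∈ affineSpan b) :
    ∃ s ∈ centralSpan (Set.univ : Set R), b * s - s * b = t := by
  obtain ⟨x, l, hl⟩ := hb.exists_commutator_inverse
  have hv := hb.commutator_mem x
  have hw := hb.mul_mem ht (Submodule.smul_mem _ l hv)
  have hbw := affineSpan_commute (left_mem_affineSpan b) hw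
  refine ⟨_, mul_mem_centralSpan_univ (hb.affineSpan_le_centralSpan hw)
    (toQuotient_mem_centralSpan (Set.mem_univ x)), ?_⟩
  rw [← mul_assoc, hbw, mul_assoc _ b, mul_assoc _ _ b, ← mul_sub, mul_assoc t,
    affineSpan_commute (Submodule.smul_mem _ l hv) hv, hl, mul_one]

/-- Writing `b = lu + k` gives `[b, s] = l[u, s]`, and `[b, RC]` is all of `Cb + C`. -/
theorem affineSpan_le_of_commutator_mem {u : SymmetricQuotient R} (hu : u ∈ affineSpan b)
    (huC : u ∉ Subring.center (SymmetricQuotient R))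
    {W : Submodule (ExtendedCentroid R) (SymmetricQuotient R)}
    (h : ∀ x, u * toQuotient R x - toQuotient R x * u ∈ W) : affineSpan b ≤ W := by
  intro t ht
  obtain ⟨s, hs, rfl⟩ := hb.exists_commutator_eq ht
  obtain ⟨l, k, hlk⟩ := mem_affineSpan.1 (mem_affineSpan_comm huC hu)
  rw [← hlk]
  have := Submodule.smul_mem _ l (innerDerivation_mem h hs)
  convert this using 1
  simp only [mul_add, add_mul, smul_mul_assoc, mul_smul_comm, mul_one, one_mul, smul_sub]
  abel

theorem rank_affineSpan : Module.rank (ExtendedCentroid R) (affineSpan b) = 2 := by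
  have h : LinearIndependent (ExtendedCentroid R) ![b, 1] := by
    refine LinearIndependent.pair_iff.2 fun s t hst => ?_
    have hs : s = 0 := by
      by_contra hs
      refine hb.notMem_center ?_
      have : b = (-(s⁻¹ * t)) • (1 : SymmetricQuotient R) := by
        rw [neg_smul, mul_smul, ← smul_neg, ← eq_neg_of_add_eq_zero_left hst, smul_smul,
          inv_mul_cancel₀ hs, one_smul]
      rw [this]
      exact smul_one_mem_center _
    rw [hs, zero_smul, zero_add] at hst
    exact ⟨hs, (smul_eq_zero.1 hst).resolve_right one_ne_zero⟩
  have h2 := rank_span h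
  have hb1 : b ∉ ({1} : Set (SymmetricQuotient R)) := fun h1 =>
    hb.notMem_center (Set.mem_singleton_iff.1 h1 ▸ one_mem _)
  rwa [Matrix.range_cons, Matrix.range_cons, Matrix.range_empty, Set.union_empty,
    Set.singleton_union, Cardinal.mk_insert hb1, Cardinal.mk_singleton, one_add_one_eq_two] at h2

/-- Rank-nullity for `[b, ·]` on `RC`, whose image and kernel are both `Cb + C`. Cardinal ranks are
used because finite dimension is only a conclusion. -/
theorem rank_centralSpan :
    Module.rank (ExtendedCentroid R) (centralSpan (Set.univ : Set R)) = 4 := by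
  let f := (innerDerivation b).domRestrict (centralSpan (Set.univ : Set R))
  have hf : ∀ s, f s = b * s - s * b := fun s => rfl
  have hrange : f.range = affineSpan b := by
    refine le_antisymm ?_ fun t ht => ?_
    · rintro _ ⟨s, rfl⟩
      exact innerDerivation_mem hb.commutator_mem s.2
    · obtain ⟨s, hs, hst⟩ := hb.exists_commutator_eq ht
      exact ⟨⟨s, hs⟩, hst⟩
  have hker : f.ker = (affineSpan b).comap (centralSpan (Set.univ : Set R)).subtype := by
    ext s
    rw [LinearMap.mem_ker, hf, sub_eq_zero]
    exact ⟨hb.mem_affineSpan_of_commute s.2, affineSpan_commute (left_mem_affineSpan b)⟩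
  have h := LinearMap.rank_range_add_rank_ker f
  rw [hrange, hker, (Submodule.comapSubtypeEquivOfLe hb.affineSpan_le_centralSpan).rank_eq,
    hb.rank_affineSpan] at h
  rw [← h]
  norm_num

theorem isExceptional : IsExceptional R := by
  have h2 : ∀ x : R, 2 • x = 0 := fun x => toQuotient_injective (by
    rw [two_nsmul, map_add, hb.add_self, map_zero])
  refine ⟨?_, by rw [Module.finrank, hb.rank_centralSpan]; simp⟩
  refine (Nat.prime_two.eq_one_or_self_of_dvd _
    (AddMonoid.exponent_dvd_of_forall_nsmul_eq_zero h2)).resolve_left fun h1 => ?_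
  have := AddMonoid.exp_eq_one_iff.1 h1
  exact not_subsingleton R this

/-- If a power of a Lie ideal `K` lies in `Cb + C`, then so does `K`. -/
theorem mem_affineSpan_of_power {K : AddSubgroup R} (hK : IsLieIdeal K) {m : ℕ} (hm : 1 ≤ m)
    (h : ∀ w ∈ power (K : Set R) m, toQuotient R w ∈ affineSpan b) :
    ∀ a ∈ K, toQuotient R a ∈ affineSpan b := by
  by_cases hc : ∀ a ∈ K, b * toQuotient R a = toQuotient R a * b
  · exact fun a ha => hb.mem_affineSpan_of_commute (toQuotient_mem_centralSpan trivial) (hc a ha)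
  -- Take `u = [b, a] ≠ 0` in `K ∩ (Cb + C)`. If `u` is central, rescale it to `1`; if not, `[u, R]
  -- ⊆ K` already spans a space containing `Cb + C`.
  have h1 : (1 : SymmetricQuotient R) ∈ centralSpan (K : Set R) := by
    push Not at hc
    obtain ⟨a, ha, hab⟩ := hc
    have huV := hb.commutator_mem a
    have hu0 := sub_ne_zero.2 hab
    obtain ⟨b', rfl⟩ := hb.mem_range
    have hu : b' * a - a * b' ∈ K := by
      rw [← neg_sub]
      exact neg_mem (isLieIdeal_iff.1 hK a ha b')
    rw [← map_mul, ← map_mul, ← map_sub] at huV hu0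
    by_cases huC : toQuotient R (b' * a - a * b') ∈ Subring.center (SymmetricQuotient R)
    · obtain ⟨l, hl⟩ := exists_smul_one_eq huC
      have hl0 : l ≠ 0 := by
        rintro rfl
        exact hu0 (by rw [← hl, zero_smul])
      have := Submodule.smul_mem _ l⁻¹ (toQuotient_mem_centralSpan (A := (K : Set R)) hu)
      rwa [← hl, smul_smul, inv_mul_cancel₀ hl0, one_smul] at this
    · refine hb.affineSpan_le_of_commutator_mem huV huC (fun x => ?_) (one_mem_affineSpan _)
      simp only [← map_mul, ← map_sub]
      exact toQuotient_mem_centralSpan (isLieIdeal_iff.1 hK _ hu x)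
  induction m, hm using Nat.le_induction with
  | base => rwa [power_one] at h
  | succ m hm ih =>
    -- As `1 ∈ KC`, `w = w·1` lies in the span of `wK ⊆ K^(m+1)`, hence in `Cb + C`.
    refine ih fun w hw => ?_
    have := (centralSpan_le (A := (K : Set R)) (W := (affineSpan b).comap
      (LinearMap.mulLeft (ExtendedCentroid R) (toQuotient R w)))).2 (fun a ha => by
        rw [Submodule.mem_comap, LinearMap.mulLeft_apply, ← map_mul]
        exact h _ (mul_mem_power hm hw ha)) h1
    simpa using this

theorem centralSpan_eq {K : AddSubgroup R} (hK : IsLieIdeal K) (hKZ : ¬ IsCentral K)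
    (h : ∀ a ∈ K, toQuotient R a ∈ affineSpan b) : centralSpan (K : Set R) = affineSpan b := by
  refine le_antisymm (centralSpan_le.2 h) ?_
  obtain ⟨a, ha, haZ⟩ : ∃ a ∈ K, a ∉ NonUnitalSubring.center R := by
    by_contra! hc
    exact hKZ hc
  refine hb.affineSpan_le_of_commutator_mem (h a ha)
    (fun hc => haZ (toQuotient_mem_center.1 hc)) fun x => ?_
  simp only [← map_mul, ← map_sub]
  exact toQuotient_mem_centralSpan (isLieIdeal_iff.1 hK a ha x)

end IsInseparable

/-! ### Noncentrality of powers, and the main theorem. -/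

/-- If `K^(m+1)` were central, comparing `(xw)y = x(wy)` for `w ∈ K^m` and `x, y ∈ K` would put `K`
on one line `Cx`. Then `K` commutes with itself, so `KC = Cb + C` contains `1`; hence `Cx = C` and
`K` is central. -/
theorem not_isCentral_power {K : AddSubgroup R} (hK : IsLieIdeal K) (hKZ : ¬ IsCentral K) {m : ℕ}
    (hm : 1 ≤ m) : ¬ IsCentral (power (K : Set R) m) := by
  obtain rfl | ⟨m, hm1, rfl⟩ : m = 1 ∨ ∃ k, 1 ≤ k ∧ m = k + 1 := by
    rcases hm.eq_or_lt with h | h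
    · exact .inl h.symm
    · exact .inr ⟨m - 1, by omega, by omega⟩
  · rwa [power_one]
  intro hc
  obtain ⟨w, hw, hw0⟩ := exists_mem_power_ne_zero hK hKZ hm1
  obtain ⟨x, hx, hwx⟩ : ∃ x ∈ K, w * x ≠ 0 := by
    by_contra! h
    exact hw0 (eq_zero_of_forall_mul_lieIdeal hK hKZ h)
  have hcen : ∀ y ∈ power (K : Set R) (m + 1), ∃ l : ExtendedCentroid R,
      l • (1 : SymmetricQuotient R) = toQuotient R y := fun y hy =>
    exists_smul_one_eq (toQuotient_mem_center.2 (hc y hy))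
  obtain ⟨l, hl⟩ := hcen _ (mul_mem_power' hm1 hx w hw)
  have hx0 : toQuotient R x ≠ 0 := by
    intro h
    rw [toQuotient_injective (h.trans (map_zero _).symm), mul_zero] at hwx
    exact hwx rfl
  -- If `xw = 0`, then `x(wx) = (xw)x = 0` with `wx` a scalar, contradicting `wx ≠ 0`.
  have hl0 : l ≠ 0 := by
    rintro rfl
    obtain ⟨k, hk⟩ := hcen _ (mul_mem_power hm1 hw hx)
    have h1 : k • toQuotient R x = 0 := by
      have h2 : toQuotient R x * toQuotient R (w * x) = toQuotient R (x * w) * toQuotient R x := by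
        rw [← map_mul, ← map_mul, mul_assoc]
      rwa [← hk, ← hl, zero_smul, zero_mul, mul_smul_comm, mul_one] at h2
    rw [smul_eq_zero, or_iff_left hx0] at h1
    rw [h1, zero_smul] at hk
    exact hwx (toQuotient_injective (hk.symm.trans (map_zero _).symm))
  have hmul : ∀ y ∈ K, ∃ k : ExtendedCentroid R, toQuotient R y = k • toQuotient R x := by
    intro y hy
    obtain ⟨k, hk⟩ := hcen _ (mul_mem_power hm1 hw hy)
    have h : toQuotient R (x * w) * toQuotient R y = toQuotient R x * toQuotient R (w * y) := by
      rw [← map_mul, ← map_mul, mul_assoc]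
    rw [← hl, ← hk, smul_mul_assoc, one_mul, mul_smul_comm, mul_one] at h
    exact ⟨l⁻¹ * k, by rw [mul_smul, ← h, smul_smul, inv_mul_cancel₀ hl0, one_smul]⟩
  have hcomm : ∀ a ∈ K, ∀ b ∈ K, a * b = b * a := by
    intro a ha b hb
    obtain ⟨k, hk⟩ := hmul a ha
    obtain ⟨j, hj⟩ := hmul b hb
    refine toQuotient_injective ?_
    rw [map_mul, map_mul, hk, hj, smul_mul_smul_comm, smul_mul_smul_comm, mul_comm k]
  obtain ⟨b, hb, hbZ⟩ : ∃ a ∈ K, a ∉ NonUnitalSubring.center R := by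
    by_contra! hc
    exact hKZ hc
  obtain ⟨hins, hKb, -⟩ := isInseparable_of_commute hK hK hKZ hcomm hb hbZ
  have h1 : (1 : SymmetricQuotient R) ∈
      Submodule.span (ExtendedCentroid R) {toQuotient R x} := by
    refine (centralSpan_le.2 fun y hy => ?_)
      ((hins.centralSpan_eq hK hKZ hKb).ge (one_mem_affineSpan _))
    obtain ⟨k, hk⟩ := hmul y hy
    rw [hk]
    exact Submodule.smul_mem _ _ (Submodule.mem_span_singleton_self _)
  obtain ⟨j, hj⟩ := Submodule.mem_span_singleton.1 h1
  have hj0 : j ≠ 0 := by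
    rintro rfl
    rw [zero_smul] at hj
    exact zero_ne_one hj
  obtain ⟨k, hk⟩ := hmul b hb
  refine hins.notMem_center ?_
  have : toQuotient R x = j⁻¹ • (1 : SymmetricQuotient R) := by
    rw [← hj, smul_smul, inv_mul_cancel₀ hj0, one_smul]
  rw [hk, this, smul_smul]
  exact smul_one_mem_center _

end Quadratic

end PrimeLie

theorem theoremC {R : Type*} [NonUnitalRing R] [PrimeLie.IsPrimeRing R]
    (K L : AddSubgroup R) (hK : PrimeLie.IsLieIdeal K) (hL : PrimeLie.IsLieIdeal L)
    (hKZ : ¬ PrimeLie.IsCentral K) (hLZ : ¬ PrimeLie.IsCentral L)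
    (m n : ℕ) (hm : 1 ≤ m) (hn : 1 ≤ n) :
    List.TFAE [
      PrimeLie.commutator (PrimeLie.power (K : Set R) m : Set R)
        (PrimeLie.power (L : Set R) n : Set R) = ⊥,
      PrimeLie.commutator (K : Set R) (L : Set R) = ⊥,
      PrimeLie.IsExceptional R ∧
        ∀ a ∈ L, a ∉ NonUnitalSubring.center R →
          PrimeLie.centralSpan (K : Set R) = PrimeLie.centralSpan (L : Set R) ∧
          PrimeLie.centralSpan (L : Set R) =
            Submodule.span (PrimeLie.ExtendedCentroid R) {PrimeLie.toQuotient R a, 1}] := by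
  open PrimeLie in
  have exists_noncentral : ∀ {M : AddSubgroup R}, ¬ IsCentral M →
      ∃ a ∈ M, a ∉ NonUnitalSubring.center R := by
    intro M hM
    by_contra! hc
    exact hM hc
  tfae_have 2 → 1 := by
    intro h
    rw [PrimeLie.commutator_eq_bot_iff] at h ⊢
    exact fun a ha b hb => PrimeLie.commute_of_mem_power (fun x hx =>
      (PrimeLie.commute_of_mem_power (fun y hy => (h x hx y hy).symm) hn b hb).symm) hm a ha
  tfae_have 1 → 2 := by
    intro h
    rw [PrimeLie.commutator_eq_bot_iff] at h ⊢
    -- Here `b` is taken in `L^n`, not in `L`: the commuting Lie ideals are the powers, and `K` and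
    -- `L` are then pulled into the same `Cb + C`.
    obtain ⟨b, hb, hbZ⟩ := exists_noncentral (PrimeLie.not_isCentral_power hL hLZ hn)
    obtain ⟨hins, hKb, hLb⟩ := PrimeLie.isInseparable_of_commute
      (PrimeLie.isLieIdeal_power hL hn) (PrimeLie.isLieIdeal_power hK hm)
      (PrimeLie.not_isCentral_power hK hKZ hm) h hb hbZ
    intro x hx y hy
    refine PrimeLie.toQuotient_injective ?_
    rw [map_mul, map_mul]
    exact PrimeLie.affineSpan_commute (hins.mem_affineSpan_of_power hK hm hKb x hx)
      (hins.mem_affineSpan_of_power hL hn hLb y hy)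
  tfae_have 2 → 3 := by
    intro h
    rw [PrimeLie.commutator_eq_bot_iff] at h
    have key := fun b hb hbZ => PrimeLie.isInseparable_of_commute (b := b) hL hK hKZ h hb hbZ
    obtain ⟨b, hb, hbZ⟩ := exists_noncentral hLZ
    refine ⟨(key b hb hbZ).1.isExceptional, fun a ha haZ => ?_⟩
    obtain ⟨hins, hKb, hLb⟩ := key a ha haZ
    have hLa := hins.centralSpan_eq hL hLZ hLb
    exact ⟨(hins.centralSpan_eq hK hKZ hKb).trans hLa.symm, hLa⟩
  tfae_have 3 → 2 := by
    rintro ⟨-, h⟩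
    rw [PrimeLie.commutator_eq_bot_iff]
    obtain ⟨b, hb, hbZ⟩ := exists_noncentral hLZ
    obtain ⟨h1, h2⟩ := h b hb hbZ
    intro x hx y hy
    refine PrimeLie.toQuotient_injective ?_
    rw [map_mul, map_mul]
    exact PrimeLie.affineSpan_commute (b := PrimeLie.toQuotient R b)
      ((h1.trans h2).le (PrimeLie.toQuotient_mem_centralSpan hx))
      (h2.le (PrimeLie.toQuotient_mem_centralSpan hy))
  tfae_finish
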